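/- Let $P$ be an arbitrary Borel probability measure on $\mathbb R^d$, $X$ a random vector with law $P$, $\delta\in(0,\infty)$, and $z,u\in\mathbb R^d$ with $\|u\|=1$ (Euclidean norm). Put $Y=\langle u,z-X\rangle$, let $P_Y$ be the law of $Y$, and write $a^+=\max(a,0)$, $a^-=\max(-a,0)$. Let $d_W(P',P)=\inf_\Pi\int\|x-y\|\,\Pi(dx,dy)\in[0,\infty]$, where $\Pi$ runs over the probability laws on $\mathbb R^d\times\mathbb R^d$ with marginals $P'$ and $P$, and let $d_W^1$ be the analogous distance for laws on $\mathbb R$ with cost $|x-y|$. For $y\ge 0$ put $$h(y)=E\big(Y\,1\{0<Y\le y\}\big),\quad \underline h(y)=E\big(-Y\,1\{0<-Y\le y\}\big),$$ $$\lambda=\inf\{y\ge 0: h(y)\ge\delta\},\quad \underline\lambda=\inf\{y\ge 0:\underline h(y)\ge\delta\},$$ with $\inf\emptyset=\infty$. Suprema and infima over $P'$ below are over Borel probability measures. (a) Maximization. One has $\lambda\in(0,\infty]$ and $$\sup_{P':\,d_W(P',P)\le\delta}P'\big(\{x:\langle u,x-z\rangle\ge 0\}\big)=\sup_{P':\,d_W^1(P',P_Y)\le\delta}P'\big((-\infty,0]\big)$$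 $$=\inf_{\lambda'>0}\Big\{\frac{\delta}{\lambda'}+E\Big(1-\frac{Y^+}{\lambda'}\Big)^+\Big\}=\frac{\delta}{\lambda}+E\Big(1-\frac{Y^+}{\lambda}\Big)^+,$$ where the last expression is read as $1$ if $\lambda=\infty$. If $\lambda<\infty$, this value is also equal to $$P(Y\le\lambda)-\frac{h(\lambda)-\delta}{\lambda}=P(Y<\lambda)+\frac{\delta-h(\lambda-)}{\lambda},$$ where $h(\lambda-)$ is the left limit of $h$ at $\lambda$. The value equals $1$ if and only if $E\,Y^+\le\delta$. (b) Minimization. One has $\underline\lambda\in(0,\infty]$ and $$\inf_{P':\,d_W(P',P)\le\delta}P'\big(\{x:\langle u,x-z\rangle>0\}\big)=\inf_{P':\,d_W^1(P',P_Y)\le\delta}P'\big((-\infty,0)\big)=P(Y<-\underline\lambda)+\frac{\underline h(\underline\lambda)-\delta}{\underline\lambda},$$ where the last expression is read as $0$ if $\underline\lambda=\infty$. The value equals $0$ if and only if $E\,Y^-\le\delta$. -/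

import Mathlib

open MeasureTheory
open scoped ENNReal NNReal RealInnerProductSpace

noncomputable section

/-- The couplings of `μ` and `ν`: the laws on `E × E` with marginals `μ` and `ν`.
(If `μ` is a probability measure, then so is every coupling.) -/
def couplings {E : Type*} [MeasurableSpace E] (μ ν : Measure E) : Set (Measure (E × E)) :=
  {π | π.fst = μ ∧ π.snd = ν}

/-- The Wasserstein distance with the cost `‖x - y‖`, with values in `[0, ∞]`. It is used on
`ℝ^d` with the Euclidean norm, and on `ℝ`, where the cost is `|x - y|`. -/
def wassersteinDist {E : Type*} [NormedAddCommGroup E] [MeasurableSpace E]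
    (μ ν : Measure E) : ℝ≥0∞ :=
  ⨅ π ∈ couplings μ ν, ∫⁻ p, ‖p.1 - p.2‖ₑ ∂π

/-- The probability measures at Wasserstein distance at most `δ` from `μ`. -/
def wassersteinBall {E : Type*} [NormedAddCommGroup E] [MeasurableSpace E]
    (μ : Measure E) (δ : ℝ) : Set (Measure E) :=
  {ν | IsProbabilityMeasure ν ∧ wassersteinDist ν μ ≤ ENNReal.ofReal δ}

/-- The supremum of `ν A` over the laws `ν` in the Wasserstein ball. It is a supremum of a set of
reals in `[0, 1]`, nonempty when `μ` is a probability measure and `0 ≤ δ`, because it then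
contains the value at `μ`. -/
def maxProb {E : Type*} [NormedAddCommGroup E] [MeasurableSpace E]
    (μ : Measure E) (δ : ℝ) (A : Set E) : ℝ :=
  sSup ((fun ν : Measure E => ν.real A) '' wassersteinBall μ δ)

/-- The infimum of `ν A` over the laws `ν` in the Wasserstein ball. -/
def minProb {E : Type*} [NormedAddCommGroup E] [MeasurableSpace E]
    (μ : Measure E) (δ : ℝ) (A : Set E) : ℝ :=
  sInf ((fun ν : Measure E => ν.real A) '' wassersteinBall μ δ)

/-- The truncated expectation `h(y) = E (Y 1{Y ∈ (0, y]})` of a random variable `Y`. -/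
def truncExp {Ω : Type*} [MeasurableSpace Ω] (P : Measure Ω) (Y : Ω → ℝ) (y : ℝ) : ℝ :=
  ∫ ω, (Y ⁻¹' Set.Ioc 0 y).indicator Y ω ∂P

/-- The left-inverse `h⁻¹(δ) = inf {y ≥ 0 : h(y) ≥ δ}` of the truncated expectation, with values
in `[0, ∞]`, where `inf ∅ = ∞`. -/
def truncInv {Ω : Type*} [MeasurableSpace Ω] (P : Measure Ω) (Y : Ω → ℝ) (δ : ℝ) : ℝ≥0∞ :=
  ⨅ y ∈ {y : ℝ≥0 | δ ≤ truncExp P Y y}, (y : ℝ≥0∞)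

/-- The objective `δ / l + E (1 - Y⁺ / l)⁺`, for a real number `l > 0`. -/
def dualObj {Ω : Type*} [MeasurableSpace Ω] (P : Measure Ω) (Y : Ω → ℝ) (δ l : ℝ) : ℝ :=
  δ / l + ∫ ω, (1 - (Y ω)⁺ / l)⁺ ∂P

end

open Filter Topology Set

/-! ### Extremal probabilities over Wasserstein balls. -/

section General

variable {E : Type*} [NormedAddCommGroup E] [MeasurableSpace E]

/-! The half-space is `{Y ≤ 0}`. Since `Y` is 1-Lipschitz, `1{Y x ≤ 0} ≤ ‖x - y‖ / l + (1 - Y(y)⁺ /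
l)⁺` for every `l > 0`; integrating over a coupling bounds the maximum by the dual objective
(`maxProb_le_dualObj`). Conversely, a point can be moved into the half-space along `u` at cost `Y⁺`
(`lintegral_weight_le_maxProb`). The budget `δ` is best spent on the cheapest mass: all of `{Y < λ}`
and a fraction of the atom `{Y = λ}`. This attains the dual value at `λ`
(`maxProb_eq_of_truncInv_ne_top`). If `λ = ∞`, then `E Y⁺ ≤ δ` and all mass can be moved. The
argument uses only that `Y` is 1-Lipschitz and decreases at unit rate along some `v` with `‖v‖ ≤ 1`.
So it also covers the identity on `ℝ`, which gives the one-dimensional problem, and `-Y`, which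
gives the minimum through complements. -/

theorem wassersteinDist_self [BorelSpace E] [SecondCountableTopology E] (μ : Measure E) :
    wassersteinDist μ μ = 0 := by
  refine le_antisymm ?_ zero_le
  have hm : Measurable fun x : E => (x, x) := measurable_id.prodMk measurable_id
  have hmem : (μ.map fun x => (x, x)) ∈ couplings μ μ := ⟨?_, ?_⟩
  · refine (iInf₂_le _ hmem).trans ?_
    rw [lintegral_map (by fun_prop) hm]
    simp
  · rw [Measure.fst, Measure.map_map measurable_fst hm]
    exact Measure.map_id
  · rw [Measure.snd, Measure.map_map measurable_snd hm]
    exact Measure.map_id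

theorem self_mem_wassersteinBall [BorelSpace E] [SecondCountableTopology E] (μ : Measure E)
    [IsProbabilityMeasure μ] (δ : ℝ) : μ ∈ wassersteinBall μ δ :=
  ⟨inferInstance, by simp [wassersteinDist_self]⟩

theorem bddAbove_image_wassersteinBall (μ : Measure E) (δ : ℝ) (A : Set E) :
    BddAbove ((fun ν : Measure E => ν.real A) '' wassersteinBall μ δ) := by
  refine ⟨1, ?_⟩
  rintro _ ⟨ν, ⟨hν, -⟩, rfl⟩
  exact measureReal_le_one

theorem bddBelow_image_wassersteinBall (μ : Measure E) (δ : ℝ) (A : Set E) :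
    BddBelow ((fun ν : Measure E => ν.real A) '' wassersteinBall μ δ) := by
  refine ⟨0, ?_⟩
  rintro _ ⟨ν, -, rfl⟩
  exact measureReal_nonneg

theorem measureReal_le_maxProb {μ ν : Measure E} {δ : ℝ} (hν : ν ∈ wassersteinBall μ δ)
    (A : Set E) : ν.real A ≤ maxProb μ δ A :=
  le_csSup (bddAbove_image_wassersteinBall μ δ A) ⟨ν, hν, rfl⟩

theorem maxProb_le [BorelSpace E] [SecondCountableTopology E] {μ : Measure E}
    [IsProbabilityMeasure μ] {δ : ℝ} {A : Set E} {c : ℝ}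
    (h : ∀ ν ∈ wassersteinBall μ δ, ν.real A ≤ c) : maxProb μ δ A ≤ c := by
  refine csSup_le (Set.Nonempty.image _ ⟨μ, self_mem_wassersteinBall μ δ⟩) ?_
  rintro _ ⟨ν, hν, rfl⟩
  exact h ν hν

theorem maxProb_le_one [BorelSpace E] [SecondCountableTopology E] (μ : Measure E)
    [IsProbabilityMeasure μ] (δ : ℝ) (A : Set E) : maxProb μ δ A ≤ 1 :=
  maxProb_le fun ν hν => by
    have := hν.1
    exact measureReal_le_one

theorem minProb_eq_one_sub_maxProb_compl [BorelSpace E] [SecondCountableTopology E]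
    (μ : Measure E) [IsProbabilityMeasure μ] (δ : ℝ) {A : Set E} (hA : MeasurableSet A) :
    minProb μ δ A = 1 - maxProb μ δ Aᶜ := by
  apply le_antisymm
  · rw [le_sub_comm]
    refine maxProb_le fun ν hν => ?_
    have := hν.1
    rw [probReal_compl_eq_one_sub hA]
    exact sub_le_sub_left (csInf_le (bddBelow_image_wassersteinBall μ δ A) ⟨ν, hν, rfl⟩) 1
  · refine le_csInf (Set.Nonempty.image _ ⟨μ, self_mem_wassersteinBall μ δ⟩) ?_
    rintro _ ⟨ν, hν, rfl⟩
    have := hν.1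
    have h1 := measureReal_le_maxProb hν Aᶜ
    rw [probReal_compl_eq_one_sub hA] at h1
    exact sub_le_comm.1 h1

end General

/-! ### The truncated expectation, its left-inverse and the dual objective. -/

section Truncation

variable {Ω : Type*} [MeasurableSpace Ω] {P : Measure Ω} {Y : Ω → ℝ}

theorem posPart_one_sub_div (y : ℝ) {l : ℝ} (hl : 0 < l) :
    (1 - y⁺ / l)⁺ = (Iio l).indicator (fun _ => (1 : ℝ)) y
      - (Ioo 0 l).indicator (fun t => t) y / l := by
  rcases le_or_gt y 0 with h0 | h0
  · have : y < l := h0.trans_lt hl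
    simp [posPart_of_nonpos h0, h0.not_gt, this]
  · rw [posPart_of_nonneg h0.le]
    rcases lt_or_ge y l with h1 | h1
    · have : 0 ≤ 1 - y / l := sub_nonneg.2 ((div_le_one hl).2 h1.le)
      simp [posPart_of_nonneg this, h0, h1]
    · have : 1 - y / l ≤ 0 := sub_nonpos.2 ((one_le_div hl).2 h1)
      simp [posPart_of_nonpos this, h1.not_gt]

theorem truncExp_eq (P : Measure Ω) (Y : Ω → ℝ) (y : ℝ) :
    truncExp P Y y = ∫ ω, (Ioc 0 y).indicator (fun t => t) (Y ω) ∂P := by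
  unfold truncExp
  congr 1

theorem dualObj_map (hY : Measurable Y) (δ l : ℝ) :
    dualObj (P.map Y) (fun t => t) δ l = dualObj P Y δ l := by
  unfold dualObj
  rw [integral_map hY.aemeasurable]
  have : Continuous fun y : ℝ => (1 - y⁺ / l)⁺ := by
    simp only [posPart_def]
    fun_prop
  exact this.aestronglyMeasurable

theorem abs_indicator_le {s : Set ℝ} {c : ℝ} (hc : 0 ≤ c) (hs : s ⊆ Icc 0 c) (y : ℝ) :
    ‖s.indicator (fun t => t) y‖ ≤ c := by
  by_cases h : y ∈ s
  · rw [indicator_of_mem h, Real.norm_eq_abs, abs_of_nonneg (hs h).1]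
    exact (hs h).2
  · simpa [h] using hc

theorem integrable_indicator_comp [IsFiniteMeasure P] (hY : Measurable Y) {s : Set ℝ}
    (hm : MeasurableSet s) {c : ℝ} (hc : 0 ≤ c) (hs : s ⊆ Icc 0 c) :
    Integrable (fun ω => s.indicator (fun t => t) (Y ω)) P :=
  Integrable.of_bound ((measurable_id.indicator hm).comp hY).aestronglyMeasurable c
    (ae_of_all _ fun _ => abs_indicator_le hc hs _)

theorem indicator_Ioc_zero_mono {a b : ℝ} (hab : a ≤ b) (y : ℝ) :
    (Ioc 0 a).indicator (fun t => t) y ≤ (Ioc 0 b).indicator (fun t => t) y := by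
  by_cases h : y ∈ Ioc 0 a
  · rw [indicator_of_mem h, indicator_of_mem (Ioc_subset_Ioc_right hab h)]
  · rw [indicator_of_notMem h]
    exact indicator_nonneg (fun t ht => ht.1.le) _

theorem truncExp_mono [IsFiniteMeasure P] (hY : Measurable Y) : Monotone (truncExp P Y) := by
  intro a b hab
  rw [truncExp_eq, truncExp_eq]
  have hi : ∀ c : ℝ, Integrable (fun ω => (Ioc 0 c).indicator (fun t => t) (Y ω)) P := fun c =>
    integrable_indicator_comp hY measurableSet_Ioc (le_max_right c 0) fun t ht =>
      ⟨ht.1.le, ht.2.trans (le_max_left _ _)⟩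
  refine integral_mono (hi a) (hi b) fun ω => ?_
  exact indicator_Ioc_zero_mono hab _

theorem tendsto_truncExp_right [IsFiniteMeasure P] (hY : Measurable Y) {l : ℝ} (hl : 0 ≤ l) :
    Tendsto (truncExp P Y) (𝓝[>] l) (𝓝 (truncExp P Y l)) := by
  simp only [funext (truncExp_eq P Y)]
  refine tendsto_integral_filter_of_dominated_convergence (fun _ => l + 1) ?_ ?_
    (integrable_const _) ?_
  · exact Eventually.of_forall fun y =>
      ((measurable_id.indicator measurableSet_Ioc).comp hY).aestronglyMeasurable
  · filter_upwards [Ioo_mem_nhdsGT (lt_add_one l)] with y hy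
    exact ae_of_all _ fun ω => abs_indicator_le (by linarith) (fun t ht =>
      ⟨ht.1.le, ht.2.trans hy.2.le⟩) _
  · refine ae_of_all _ fun ω => tendsto_const_nhds.congr' ?_
    rcases le_or_gt (Y ω) l with h | h
    · filter_upwards [self_mem_nhdsWithin] with y hy
      have h' : Y ω ≤ y := h.trans (le_of_lt hy)
      simp [indicator, h, h']
    · filter_upwards [Ioo_mem_nhdsGT h] with y hy
      simp [indicator, h.not_ge, hy.2.not_ge]

theorem tendsto_truncExp_left [IsFiniteMeasure P] (hY : Measurable Y) {l : ℝ} (hl : 0 ≤ l) :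
    Tendsto (truncExp P Y) (𝓝[<] l)
      (𝓝 (∫ ω, (Ioo 0 l).indicator (fun t => t) (Y ω) ∂P)) := by
  simp only [funext (truncExp_eq P Y)]
  refine tendsto_integral_filter_of_dominated_convergence (fun _ => l) ?_ ?_
    (integrable_const _) ?_
  · exact Eventually.of_forall fun y =>
      ((measurable_id.indicator measurableSet_Ioc).comp hY).aestronglyMeasurable
  · filter_upwards [self_mem_nhdsWithin] with y hy
    exact ae_of_all _ fun ω => abs_indicator_le hl (fun t ht =>
      ⟨ht.1.le, ht.2.trans (le_of_lt hy)⟩) _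
  · refine ae_of_all _ fun ω => tendsto_const_nhds.congr' ?_
    rcases lt_or_ge (Y ω) l with h | h
    · filter_upwards [Ioo_mem_nhdsLT h] with y hy
      simp [indicator, h, hy.1.le]
    · filter_upwards [self_mem_nhdsWithin] with y hy
      have h' : ¬ Y ω ≤ y := (lt_of_lt_of_le hy h).not_ge
      simp [indicator, h.not_gt, h']

theorem truncExp_zero (P : Measure Ω) (Y : Ω → ℝ) : truncExp P Y 0 = 0 := by
  simp [truncExp]

theorem le_truncExp_of_truncInv_lt [IsFiniteMeasure P] (hY : Measurable Y) {δ y : ℝ}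
    (h : truncInv P Y δ < ENNReal.ofReal y) : δ ≤ truncExp P Y y := by
  unfold truncInv at h
  simp only [iInf_lt_iff] at h
  obtain ⟨t, ht, hty⟩ := h
  refine ht.trans (truncExp_mono hY ?_)
  have : t < y.toNNReal := ENNReal.coe_lt_coe.1 hty
  exact (Real.lt_toNNReal_iff_coe_lt.1 this).le

theorem truncExp_lt_of_lt_truncInv {δ y : ℝ} (hδ : 0 < δ)
    (h : ENNReal.ofReal y < truncInv P Y δ) : truncExp P Y y < δ := by
  by_contra! hc
  rcases le_or_gt 0 y with hy | hy
  · refine h.not_ge (iInf₂_le y.toNNReal ?_)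
    simpa [Real.coe_toNNReal _ hy] using hc
  -- `ENNReal.ofReal` sends a negative `y` to `0`, so this case needs its own argument.
  · have : truncExp P Y y = 0 := by simp [truncExp, Ioc_eq_empty_of_le hy.le]
    linarith

/-- By right-continuity of the truncated expectation, the infimum is attained. -/
theorem le_truncExp_truncInv [IsFiniteMeasure P] (hY : Measurable Y) {δ : ℝ}
    (h : truncInv P Y δ ≠ ⊤) : δ ≤ truncExp P Y (truncInv P Y δ).toReal := by
  refine ge_of_tendsto (tendsto_truncExp_right hY ENNReal.toReal_nonneg) ?_
  filter_upwards [self_mem_nhdsWithin] with y hy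
  exact le_truncExp_of_truncInv_lt hY ((ENNReal.lt_ofReal_iff_toReal_lt h).2 hy)

theorem truncInv_pos [IsFiniteMeasure P] (hY : Measurable Y) {δ : ℝ} (hδ : 0 < δ) :
    0 < truncInv P Y δ := by
  rw [pos_iff_ne_zero]
  intro h0
  have := le_truncExp_truncInv (P := P) hY (δ := δ) (by simp [h0])
  rw [h0, ENNReal.toReal_zero, truncExp_zero] at this
  linarith

/-- The integral is the left limit `h(λ-)`, and `h < δ` below `λ`. Moving all of `{Y < λ}` is thus
within budget. -/
theorem integral_Ioo_indicator_le [IsFiniteMeasure P] (hY : Measurable Y) {δ : ℝ} (hδ : 0 < δ)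
    (h : truncInv P Y δ ≠ ⊤) :
    ∫ ω, (Ioo 0 (truncInv P Y δ).toReal).indicator (fun t => t) (Y ω) ∂P ≤ δ := by
  refine le_of_tendsto (tendsto_truncExp_left hY ENNReal.toReal_nonneg) ?_
  have hpos : 0 < (truncInv P Y δ).toReal := ENNReal.toReal_pos (truncInv_pos hY hδ).ne' h
  filter_upwards [Ioo_mem_nhdsLT hpos] with y hy
  exact (truncExp_lt_of_lt_truncInv hδ ((ENNReal.ofReal_lt_iff_lt_toReal hy.1.le h).2 hy.2)).le

theorem leftLim_truncExp [IsFiniteMeasure P] (hY : Measurable Y) {l : ℝ} (hl : 0 ≤ l) :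
    Function.leftLim (truncExp P Y) l = ∫ ω, (Ioo 0 l).indicator (fun t => t) (Y ω) ∂P :=
  leftLim_eq_of_tendsto (tendsto_truncExp_left hY hl)

/-- The jump of `h` at `l` is the cost of moving the whole atom `{Y = l}`. -/
theorem truncExp_eq_add [IsFiniteMeasure P] (hY : Measurable Y) {l : ℝ} (hl : 0 < l) :
    truncExp P Y l = ∫ ω, (Ioo 0 l).indicator (fun t => t) (Y ω) ∂P
      + l * P.real {ω | Y ω = l} := by
  have hm : MeasurableSet {ω | Y ω = l} := hY (measurableSet_singleton l)
  have h1 : l * P.real {ω | Y ω = l} = ∫ ω, {ω | Y ω = l}.indicator (fun _ => l) ω ∂P := by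
    rw [integral_indicator_const _ hm, smul_eq_mul, mul_comm]
  rw [h1, truncExp_eq, ← integral_add]
  · congr 1
    ext ω
    rcases lt_trichotomy (Y ω) l with h | h | h
    · simp [indicator, h, h.le, h.ne]
    · simp [indicator, h, hl]
    · simp [indicator, h.not_ge, h.not_gt, h.ne']
  · exact integrable_indicator_comp hY measurableSet_Ioo hl.le Ioo_subset_Icc_self
  · exact (integrable_const l).indicator hm

theorem measureReal_le_eq_add [IsFiniteMeasure P] (hY : Measurable Y) (l : ℝ) :
    P.real {ω | Y ω ≤ l} = P.real {ω | Y ω < l} + P.real {ω | Y ω = l} := by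
  rw [← measureReal_union (s₂ := {ω | Y ω = l}) _ (hY (measurableSet_singleton l))]
  · congr 1
    ext ω
    exact le_iff_lt_or_eq (a := Y ω)
  · exact Set.disjoint_left.2 fun ω h h' => (ne_of_lt (a := Y ω) h) h'

theorem dualObj_eq [IsFiniteMeasure P] (hY : Measurable Y) (δ : ℝ) {l : ℝ} (hl : 0 < l) :
    dualObj P Y δ l = P.real {ω | Y ω < l}
      + (δ - ∫ ω, (Ioo 0 l).indicator (fun t => t) (Y ω) ∂P) / l := by
  unfold dualObj
  simp only [posPart_one_sub_div _ hl]
  have hm : MeasurableSet {ω | Y ω < l} := hY measurableSet_Iio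
  have h1 : (fun ω => (Iio l).indicator (fun _ => (1 : ℝ)) (Y ω))
      = {ω | Y ω < l}.indicator fun _ => 1 := by
    ext ω
    simp [indicator]
  rw [integral_sub, integral_div, h1, integral_indicator_const _ hm, smul_eq_mul]
  · ring
  · rw [h1]
    exact (integrable_const _).indicator hm
  · exact (integrable_indicator_comp hY measurableSet_Ioo hl.le Ioo_subset_Icc_self).div_const l

theorem ofReal_truncExp [IsFiniteMeasure P] (hY : Measurable Y) {y : ℝ} (hy : 0 ≤ y) :
    ENNReal.ofReal (truncExp P Y y)
      = ∫⁻ ω, ENNReal.ofReal ((Ioc 0 y).indicator (fun t => t) (Y ω)) ∂P := by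
  rw [truncExp_eq, ofReal_integral_eq_lintegral_ofReal
    (integrable_indicator_comp hY measurableSet_Ioc hy Ioc_subset_Icc_self)]
  exact ae_of_all _ fun ω => indicator_nonneg (fun t ht => ht.1.le) _

/-- Monotone convergence along integer truncation levels. The Lebesgue integral keeps `E Y⁺ = ∞`
distinct from `0`. -/
theorem lintegral_posPart_le_of_truncExp_le [IsFiniteMeasure P] (hY : Measurable Y) {δ : ℝ}
    (h : ∀ y, 0 ≤ y → truncExp P Y y ≤ δ) :
    ∫⁻ ω, ENNReal.ofReal (Y ω)⁺ ∂P ≤ ENNReal.ofReal δ := by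
  have hlim : Tendsto (fun n : ℕ =>
      ∫⁻ ω, ENNReal.ofReal ((Ioc 0 (n : ℝ)).indicator (fun t => t) (Y ω)) ∂P) atTop
      (𝓝 (∫⁻ ω, ENNReal.ofReal (Y ω)⁺ ∂P)) := by
    refine lintegral_tendsto_of_tendsto_of_monotone (fun n => ?_) (ae_of_all _ fun ω => ?_)
      (ae_of_all _ fun ω => ?_)
    · exact (ENNReal.measurable_ofReal.comp
        ((measurable_id.indicator measurableSet_Ioc).comp hY)).aemeasurable
    · intro m n hmn
      refine ENNReal.ofReal_le_ofReal ?_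
      exact indicator_Ioc_zero_mono (Nat.cast_le.2 hmn) _
    · refine tendsto_const_nhds.congr' ?_
      obtain ⟨N, hN⟩ := exists_nat_ge (Y ω)
      filter_upwards [eventually_ge_atTop N] with n hn
      have hYn : Y ω ≤ n := hN.trans (Nat.cast_le.2 hn)
      rcases le_or_gt (Y ω) 0 with h0 | h0
      · simp [indicator, h0.not_gt, posPart_of_nonpos h0]
      · simp [indicator, h0, hYn, posPart_of_nonneg h0.le]
  refine le_of_tendsto' hlim fun n => ?_
  rw [← ofReal_truncExp hY n.cast_nonneg]
  exact ENNReal.ofReal_le_ofReal (h n n.cast_nonneg)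

theorem lintegral_posPart_le_of_truncInv_eq_top [IsFiniteMeasure P] (hY : Measurable Y) {δ : ℝ}
    (hδ : 0 < δ) (h : truncInv P Y δ = ⊤) :
    ∫⁻ ω, ENNReal.ofReal (Y ω)⁺ ∂P ≤ ENNReal.ofReal δ :=
  lintegral_posPart_le_of_truncExp_le hY fun _ _ =>
    (truncExp_lt_of_lt_truncInv hδ (by simp [h])).le

theorem lintegral_posPart_eq_of_ae_le [IsFiniteMeasure P] (hY : Measurable Y) {l : ℝ}
    (hl : 0 ≤ l) (h : ∀ᵐ ω ∂P, Y ω ≤ l) :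
    ∫⁻ ω, ENNReal.ofReal (Y ω)⁺ ∂P = ENNReal.ofReal (truncExp P Y l) := by
  rw [ofReal_truncExp hY hl]
  refine lintegral_congr_ae ?_
  filter_upwards [h] with ω hω
  rcases le_or_gt (Y ω) 0 with h0 | h0
  · simp [indicator, h0.not_gt, posPart_of_nonpos h0]
  · simp [indicator, h0, hω, posPart_of_nonneg h0.le]

theorem dualObj_le [IsProbabilityMeasure P] (hY : Measurable Y) (δ : ℝ) {l : ℝ} (hl : 0 < l) :
    dualObj P Y δ l ≤ δ / l + 1 := by
  rw [dualObj_eq hY δ hl]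
  have h1 : P.real {ω | Y ω < l} ≤ 1 := measureReal_le_one
  have h2 : 0 ≤ ∫ ω, (Ioo 0 l).indicator (fun t => t) (Y ω) ∂P :=
    integral_nonneg fun ω => indicator_nonneg (fun t ht => ht.1.le) _
  have h3 := div_nonneg h2 hl.le
  rw [sub_div]
  linarith

end Truncation

/-! ### Weak duality, the optimal transport plan, and reduction to the line. -/

section Duality

variable {E : Type*} [NormedAddCommGroup E] [MeasurableSpace E] [BorelSpace E]
  [SecondCountableTopology E] {P : Measure E} [IsProbabilityMeasure P] {Y : E → ℝ}

omit [IsProbabilityMeasure P] in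
theorem measure_nonpos_le_lintegral_coupling (hY : Measurable Y)
    (hL : ∀ x y, |Y x - Y y| ≤ ‖x - y‖) {l : ℝ} (hl : 0 < l) {ν : Measure E}
    {π : Measure (E × E)} (hπ : π ∈ couplings ν P) :
    ν {x | Y x ≤ 0} ≤ (∫⁻ p, ‖p.1 - p.2‖ₑ ∂π) / ENNReal.ofReal l
      + ∫⁻ x, ENNReal.ofReal (1 - (Y x)⁺ / l)⁺ ∂P := by
  have hA : MeasurableSet {x | Y x ≤ 0} := hY measurableSet_Iic
  have hf : Measurable fun x => ENNReal.ofReal (1 - (Y x)⁺ / l)⁺ := by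
    simp only [posPart_def]
    fun_prop
  have hd : Measurable fun p : E × E => ‖p.1 - p.2‖ₑ := by fun_prop
  have e1 : ν {x | Y x ≤ 0} = ∫⁻ p, {x | Y x ≤ 0}.indicator 1 p.1 ∂π := by
    rw [← hπ.1, ← lintegral_indicator_one hA, Measure.fst,
      lintegral_map (measurable_one.indicator hA) measurable_fst]
  have e2 : ∫⁻ x, ENNReal.ofReal (1 - (Y x)⁺ / l)⁺ ∂P
      = ∫⁻ p, ENNReal.ofReal (1 - (Y p.2)⁺ / l)⁺ ∂π := by
    rw [← hπ.2, Measure.snd, lintegral_map hf measurable_snd]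
  rw [e1, e2, ENNReal.div_eq_inv_mul, ← lintegral_const_mul _ hd, ← lintegral_add_left
    (hd.const_mul _)]
  refine lintegral_mono fun p => ?_
  by_cases hp : Y p.1 ≤ 0
  · simp only [indicator, mem_ofPred_eq, hp, if_true, Pi.one_apply]
    have h1 : (Y p.2)⁺ ≤ ‖p.1 - p.2‖ := by
      refine sup_le ?_ (norm_nonneg _)
      have := (abs_le.1 (hL p.1 p.2)).1
      linarith
    rw [← ofReal_norm, ← ENNReal.div_eq_inv_mul, ← ENNReal.ofReal_div_of_pos hl,
      ← ENNReal.ofReal_add (by positivity) (posPart_nonneg _), ← ENNReal.ofReal_one]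
    refine ENNReal.ofReal_le_ofReal ?_
    have h2 := le_posPart (1 - (Y p.2)⁺ / l)
    have h3 : (Y p.2)⁺ / l ≤ ‖p.1 - p.2‖ / l := by gcongr
    linarith
  · simp [indicator, hp]

theorem maxProb_le_dualObj (hY : Measurable Y) (hL : ∀ x y, |Y x - Y y| ≤ ‖x - y‖) {δ : ℝ}
    (hδ : 0 ≤ δ) {l : ℝ} (hl : 0 < l) : maxProb P δ {x | Y x ≤ 0} ≤ dualObj P Y δ l := by
  have hc : Continuous fun y : ℝ => (1 - y⁺ / l)⁺ := by
    simp only [posPart_def]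
    fun_prop
  have hint : Integrable (fun x => (1 - (Y x)⁺ / l)⁺) P := by
    refine Integrable.of_bound (hc.measurable.comp hY).aestronglyMeasurable 1
      (ae_of_all _ fun x => ?_)
    rw [Real.norm_eq_abs, abs_of_nonneg (posPart_nonneg _)]
    refine sup_le ?_ zero_le_one
    have : 0 ≤ (Y x)⁺ / l := div_nonneg (posPart_nonneg _) hl.le
    linarith
  have hn : 0 ≤ ∫ x, (1 - (Y x)⁺ / l)⁺ ∂P := integral_nonneg fun x => posPart_nonneg _
  refine maxProb_le fun ν hν => ?_
  have := hν.1
  refine (ENNReal.ofReal_le_ofReal_iff (add_nonneg (by positivity) hn)).1 ?_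
  rw [ofReal_measureReal, ENNReal.ofReal_add (by positivity) hn,
    ofReal_integral_eq_lintegral_ofReal hint (ae_of_all _ fun x => posPart_nonneg _),
    ENNReal.ofReal_div_of_pos hl]
  refine le_trans ?_ (add_le_add_left (ENNReal.div_le_div_right hν.2 _) _)
  unfold wassersteinDist
  have hl0 : ENNReal.ofReal l ≠ 0 := by simpa using hl
  -- Isolating the transport cost on the right lets the bound pass to the infimum over couplings.
  rw [← tsub_le_iff_right, ENNReal.le_div_iff_mul_le (Or.inl hl0) (Or.inl ENNReal.ofReal_ne_top)]
  refine le_iInf₂ fun π hπ => ?_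
  rw [← ENNReal.le_div_iff_mul_le (Or.inl hl0) (Or.inl ENNReal.ofReal_ne_top), tsub_le_iff_right]
  exact measure_nonpos_le_lintegral_coupling hY hL hl hπ

variable [NormedSpace ℝ E]

/-- Here `w x` is the fraction of the mass at `x` that is moved into `{Y ≤ 0}`; the rest stays in
place. -/
theorem lintegral_weight_le_maxProb (hY : Measurable Y) {v : E} (hv : ‖v‖ ≤ 1)
    (hs : ∀ x t, Y (x + t • v) = Y x - t) {δ : ℝ} {w : E → ℝ≥0∞} (hw : Measurable w)
    (hw1 : ∀ x, w x ≤ 1) (hcost : ∫⁻ x, w x * ENNReal.ofReal (Y x)⁺ ∂P ≤ ENNReal.ofReal δ) :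
    ∫⁻ x, w x ∂P ≤ ENNReal.ofReal (maxProb P δ {x | Y x ≤ 0}) := by
  -- Moves `x` to the boundary `{Y = 0}`, and fixes `x` if `Y x ≤ 0` already.
  set T : E → E := fun x => x + (Y x)⁺ • v with hT
  have hTm : Measurable T := by
    simp only [hT, posPart_def]
    fun_prop
  have hA : MeasurableSet {x | Y x ≤ 0} := hY measurableSet_Iic
  have hTA : ∀ x, Y (T x) ≤ 0 := fun x => by
    rw [hT, hs]
    exact sub_nonpos.2 (le_posPart _)
  have hsum : P.withDensity w + P.withDensity (1 - w) = P := by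
    rw [← withDensity_add_left hw, add_tsub_cancel_of_le fun x => hw1 x, withDensity_one]
  have hm1 : Measurable fun x => (T x, x) := hTm.prodMk measurable_id
  have hm2 : Measurable fun x : E => (x, x) := measurable_id.prodMk measurable_id
  set π : Measure (E × E) :=
    (P.withDensity w).map (fun x => (T x, x)) + (P.withDensity (1 - w)).map fun x => (x, x)
    with hπ
  have hsnd : π.snd = P := by
    rw [hπ, Measure.snd, Measure.map_add _ _ measurable_snd, Measure.map_map measurable_snd hm1,
      Measure.map_map measurable_snd hm2]
    conv_rhs => rw [← hsum]
    congr 1 <;> exact Measure.map_id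
  have hfst : π.fst = (P.withDensity w).map T + P.withDensity (1 - w) := by
    rw [hπ, Measure.fst, Measure.map_add _ _ measurable_fst, Measure.map_map measurable_fst hm1,
      Measure.map_map measurable_fst hm2]
    congr 1
    exact Measure.map_id
  have hprob : IsProbabilityMeasure π.fst := by
    constructor
    rw [Measure.fst_univ, ← Measure.snd_univ, hsnd, measure_univ]
  have hmem : π.fst ∈ wassersteinBall P δ := by
    refine ⟨hprob, (iInf₂_le π ⟨rfl, hsnd⟩).trans (le_trans ?_ hcost)⟩
    have hd : Measurable fun p : E × E => ‖p.1 - p.2‖ₑ := by fun_prop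
    rw [hπ, lintegral_add_measure, lintegral_map hd hm1, lintegral_map hd hm2,
      lintegral_withDensity_eq_lintegral_mul _ hw (g := fun x => ‖(T x, x).1 - (T x, x).2‖ₑ)
        (hd.comp hm1)]
    simp only [sub_self, enorm_zero, lintegral_zero, add_zero, Pi.mul_apply]
    refine lintegral_mono fun x => mul_le_mul_right ?_ _
    have : ‖T x - x‖ ≤ (Y x)⁺ := by
      simp only [hT, add_sub_cancel_left, norm_smul, Real.norm_eq_abs,
        abs_of_nonneg (posPart_nonneg (Y x))]
      exact mul_le_of_le_one_right (posPart_nonneg _) hv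
    rw [← ofReal_norm]
    exact ENNReal.ofReal_le_ofReal this
  refine le_trans ?_ (ENNReal.ofReal_le_ofReal (measureReal_le_maxProb hmem _))
  rw [ofReal_measureReal, hfst, Measure.add_apply, Measure.map_apply hTm hA]
  have : T ⁻¹' {x | Y x ≤ 0} = univ := eq_univ_of_forall hTA
  rw [this, withDensity_apply _ MeasurableSet.univ, setLIntegral_univ]
  -- The unmoved mass that happens to lie in `{Y ≤ 0}` is dropped.
  exact le_self_add

theorem maxProb_eq_one_of_lintegral_le (hY : Measurable Y) {v : E} (hv : ‖v‖ ≤ 1)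
    (hs : ∀ x t, Y (x + t • v) = Y x - t) {δ : ℝ}
    (h : ∫⁻ x, ENNReal.ofReal (Y x)⁺ ∂P ≤ ENNReal.ofReal δ) :
    maxProb P δ {x | Y x ≤ 0} = 1 := by
  refine le_antisymm (maxProb_le_one _ _ _) ?_
  have := lintegral_weight_le_maxProb (P := P) hY hv hs (δ := δ) (w := 1) measurable_one
    (fun _ => le_rfl) (by simpa using h)
  simpa using this

theorem maxProb_eq_of_truncInv_ne_top (hY : Measurable Y)
    (hL : ∀ x y, |Y x - Y y| ≤ ‖x - y‖) {v : E} (hv : ‖v‖ ≤ 1)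
    (hs : ∀ x t, Y (x + t • v) = Y x - t) {δ : ℝ} (hδ : 0 < δ) (h : truncInv P Y δ ≠ ⊤) :
    maxProb P δ {x | Y x ≤ 0} = dualObj P Y δ (truncInv P Y δ).toReal := by
  have hl : 0 < (truncInv P Y δ).toReal := ENNReal.toReal_pos (truncInv_pos hY hδ).ne' h
  refine le_antisymm (maxProb_le_dualObj hY hL hδ.le hl) ?_
  have h1 := integral_Ioo_indicator_le hY hδ h
  have h2 := le_truncExp_truncInv hY h
  rw [truncExp_eq_add hY hl] at h2
  rw [dualObj_eq hY δ hl]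
  set l := (truncInv P Y δ).toReal
  set m := ∫ ω, (Ioo 0 l).indicator (fun t => t) (Y ω) ∂P
  set q := P.real {ω | Y ω = l}
  have hq : 0 ≤ q := measureReal_nonneg
  -- `θ` is the fraction of the atom that spends the remaining budget exactly; it exists since `m ≤
  -- δ ≤ m + l * q`. Without an atom, `m = δ` and any `θ` works.
  obtain ⟨θ, hθ0, hθ1, hθ⟩ : ∃ θ : ℝ, 0 ≤ θ ∧ θ ≤ 1 ∧ l * (θ * q) = δ - m := by
    rcases hq.eq_or_lt with h0 | h0
    · refine ⟨0, le_rfl, zero_le_one, ?_⟩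
      rw [← h0] at h2 ⊢
      linarith
    · refine ⟨(δ - m) / (l * q), div_nonneg (by linarith) (by positivity), ?_, by field_simp⟩
      rw [div_le_one (by positivity)]
      linarith
  have hmlt : MeasurableSet {x | Y x < l} := hY measurableSet_Iio
  have hmeq : MeasurableSet {x | Y x = l} := hY (measurableSet_singleton l)
  set w : E → ℝ := fun x => {x | Y x < l}.indicator (fun _ => 1) x
    + {x | Y x = l}.indicator (fun _ => θ) x with hwdef
  have hwi : ∫ x, w x ∂P = P.real {x | Y x < l} + θ * q := by
    rw [integral_add ((integrable_const _).indicator hmlt) ((integrable_const _).indicator hmeq),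
      integral_indicator_const _ hmlt, integral_indicator_const _ hmeq]
    simp [q, mul_comm]
  have hwm : Measurable w :=
    (measurable_const.indicator hmlt).add (measurable_const.indicator hmeq)
  have hw0 : ∀ x, 0 ≤ w x := fun x =>
    add_nonneg (indicator_nonneg (fun _ _ => zero_le_one) _) (indicator_nonneg (fun _ _ => hθ0) _)
  have hw1 : ∀ x, w x ≤ 1 := fun x => by
    rcases lt_trichotomy (Y x) l with h | h | h
    · simp [hwdef, indicator, h, h.ne]
    · simp [hwdef, indicator, h, hθ1]
    · simp [hwdef, indicator, h.not_gt, h.ne']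
  have hwY : ∀ x, w x * (Y x)⁺
      = (Ioo 0 l).indicator (fun t => t) (Y x) + {x | Y x = l}.indicator (fun _ => θ * l) x := by
    intro x
    rcases lt_trichotomy (Y x) l with h | h | h
    · rcases le_or_gt (Y x) 0 with h0 | h0
      · simp [indicator, h.ne, h0.not_gt, posPart_of_nonpos h0]
      · simp [hwdef, indicator, h, h.ne, h0, posPart_of_nonneg h0.le]
    · simp [hwdef, indicator, h, posPart_of_nonneg hl.le]
    · simp [hwdef, indicator, h.not_gt, h.ne']
  have hi1 : Integrable (fun x => (Ioo 0 l).indicator (fun t => t) (Y x)) P :=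
    integrable_indicator_comp hY measurableSet_Ioo hl.le Ioo_subset_Icc_self
  have hi2 : Integrable ({x | Y x = l}.indicator fun _ => θ * l) P :=
    (integrable_const _).indicator hmeq
  have hcost : ∫ x, w x * (Y x)⁺ ∂P = δ := by
    simp only [hwY]
    rw [integral_add hi1 hi2, integral_indicator_const _ hmeq, smul_eq_mul]
    change m + q * (θ * l) = δ
    linarith
  have hci : Integrable (fun x => w x * (Y x)⁺) P := by
    simp only [hwY]
    exact hi1.add hi2
  have key := lintegral_weight_le_maxProb (P := P) hY hv hs (δ := δ)
    (w := fun x => ENNReal.ofReal (w x)) hwm.ennreal_ofReal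
    (fun x => by simpa using hw1 x) (by
      simp only [← ENNReal.ofReal_mul (hw0 _)]
      rw [← ofReal_integral_eq_lintegral_ofReal hci
        (ae_of_all _ fun x => mul_nonneg (hw0 x) (posPart_nonneg _)), hcost])
  have hint : Integrable w P := ((integrable_const _).indicator hmlt).add
    ((integrable_const _).indicator hmeq)
  rw [← ofReal_integral_eq_lintegral_ofReal hint (ae_of_all _ hw0), hwi] at key
  have hS : 0 ≤ maxProb P δ {x | Y x ≤ 0} :=
    measureReal_nonneg.trans (measureReal_le_maxProb (self_mem_wassersteinBall P δ) _)
  have hfin := (ENNReal.ofReal_le_ofReal_iff hS).1 key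
  have : (δ - m) / l = θ * q := by rw [← hθ, mul_div_cancel_left₀ _ hl.ne']
  rwa [this]

theorem maxProb_eq_measureReal_le_sub (hY : Measurable Y)
    (hL : ∀ x y, |Y x - Y y| ≤ ‖x - y‖) {v : E} (hv : ‖v‖ ≤ 1)
    (hs : ∀ x t, Y (x + t • v) = Y x - t) {δ : ℝ} (hδ : 0 < δ) (h : truncInv P Y δ ≠ ⊤) :
    maxProb P δ {x | Y x ≤ 0} = P.real {x | Y x ≤ (truncInv P Y δ).toReal}
      - (truncExp P Y (truncInv P Y δ).toReal - δ) / (truncInv P Y δ).toReal := by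
  have hl : 0 < (truncInv P Y δ).toReal := ENNReal.toReal_pos (truncInv_pos hY hδ).ne' h
  rw [maxProb_eq_of_truncInv_ne_top hY hL hv hs hδ h, dualObj_eq hY δ hl, truncExp_eq_add hY hl,
    measureReal_le_eq_add hY]
  field_simp
  ring

theorem maxProb_eq_iInf_dualObj (hY : Measurable Y)
    (hL : ∀ x y, |Y x - Y y| ≤ ‖x - y‖) {v : E} (hv : ‖v‖ ≤ 1)
    (hs : ∀ x t, Y (x + t • v) = Y x - t) {δ : ℝ} (hδ : 0 < δ) :
    maxProb P δ {x | Y x ≤ 0} = ⨅ l : Ioi (0 : ℝ), dualObj P Y δ l := by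
  have hle : ∀ l : Ioi (0 : ℝ), maxProb P δ {x | Y x ≤ 0} ≤ dualObj P Y δ l := fun l =>
    maxProb_le_dualObj hY hL hδ.le l.2
  have hbdd : BddBelow (range fun l : Ioi (0 : ℝ) => dualObj P Y δ l) :=
    ⟨_, forall_mem_range.2 hle⟩
  have : Nonempty (Ioi (0 : ℝ)) := ⟨⟨1, mem_Ioi.2 one_pos⟩⟩
  refine le_antisymm (le_ciInf hle) ?_
  by_cases h : truncInv P Y δ = ⊤
  · rw [maxProb_eq_one_of_lintegral_le hY hv hs (lintegral_posPart_le_of_truncInv_eq_top hY hδ h)]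
    refine le_of_forall_pos_le_add fun ε hε => ?_
    -- With `l = δ / ε`, the bound `δ / l + 1` is `1 + ε`.
    refine (ciInf_le hbdd ⟨δ / ε, div_pos hδ hε⟩).trans
      ((dualObj_le hY δ (div_pos hδ hε)).trans (le_of_eq ?_))
    field_simp
    ring
  · rw [maxProb_eq_of_truncInv_ne_top hY hL hv hs hδ h]
    exact ciInf_le hbdd ⟨_, ENNReal.toReal_pos (truncInv_pos hY hδ).ne' h⟩

/-- For finite `λ` the value is `P(Y ≤ λ)` minus a nonnegative term. Value `1` forces `Y ≤ λ` almost
surely and `h(λ) = δ`, so `E Y⁺ = h(λ) = δ`. -/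
theorem maxProb_eq_one_iff (hY : Measurable Y)
    (hL : ∀ x y, |Y x - Y y| ≤ ‖x - y‖) {v : E} (hv : ‖v‖ ≤ 1)
    (hs : ∀ x t, Y (x + t • v) = Y x - t) {δ : ℝ} (hδ : 0 < δ) :
    maxProb P δ {x | Y x ≤ 0} = 1 ↔ ∫⁻ x, ENNReal.ofReal (Y x)⁺ ∂P ≤ ENNReal.ofReal δ := by
  refine ⟨fun hS => ?_, maxProb_eq_one_of_lintegral_le hY hv hs⟩
  by_cases h : truncInv P Y δ = ⊤
  · exact lintegral_posPart_le_of_truncInv_eq_top hY hδ h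
  have hl : 0 < (truncInv P Y δ).toReal := ENNReal.toReal_pos (truncInv_pos hY hδ).ne' h
  have h2 := le_truncExp_truncInv hY h
  rw [maxProb_eq_measureReal_le_sub hY hL hv hs hδ h] at hS
  set l := (truncInv P Y δ).toReal
  have h1 : P.real {x | Y x ≤ l} ≤ 1 := measureReal_le_one
  have h3 : 0 ≤ (truncExp P Y l - δ) / l := div_nonneg (by linarith) hl.le
  have h4 : P.real {x | Y x ≤ l} = 1 := by linarith
  have h5 : (truncExp P Y l - δ) / l = 0 := by linarith
  have h6 : truncExp P Y l = δ := by
    rcases div_eq_zero_iff.1 h5 with h5 | h5 <;> linarith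
  have hae : ∀ᵐ x ∂P, Y x ≤ l := by
    refine (mem_ae_iff_prob_eq_one (hY measurableSet_Iic)).2 ?_
    have := ofReal_measureReal (μ := P) (s := {x | Y x ≤ l})
    rw [h4, ENNReal.ofReal_one] at this
    exact this.symm
  rw [lintegral_posPart_eq_of_ae_le hY hl.le hae, h6]

/-- Both sides are infima of the same dual objective, which depends only on the law of `Y`. -/
theorem maxProb_map_eq (hY : Measurable Y)
    (hL : ∀ x y, |Y x - Y y| ≤ ‖x - y‖) {v : E} (hv : ‖v‖ ≤ 1)
    (hs : ∀ x t, Y (x + t • v) = Y x - t) {δ : ℝ} (hδ : 0 < δ) :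
    maxProb P δ {x | Y x ≤ 0} = maxProb (P.map Y) δ {y | y ≤ 0} := by
  have : IsProbabilityMeasure (P.map Y) := Measure.isProbabilityMeasure_map hY.aemeasurable
  rw [maxProb_eq_iInf_dualObj hY hL hv hs hδ]
  have := maxProb_eq_iInf_dualObj (P := P.map Y) (Y := fun t : ℝ => t) (v := -1) measurable_id
    (fun _ _ => le_rfl) (by simp) (fun x t => by simp [sub_eq_add_neg]) hδ
  simp only [dualObj_map hY] at this
  exact this.symm

omit [NormedSpace ℝ E] in
theorem minProb_eq_one_sub_maxProb_neg (hY : Measurable Y) (δ : ℝ) :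
    minProb P δ {x | Y x < 0} = 1 - maxProb P δ {x | -Y x ≤ 0} := by
  rw [minProb_eq_one_sub_maxProb_compl P δ (A := {x | Y x < 0}) (hY measurableSet_Iio)]
  congr 2
  ext x
  simp

theorem minProb_map_eq (hY : Measurable Y)
    (hL : ∀ x y, |Y x - Y y| ≤ ‖x - y‖) {v : E} (hv : ‖v‖ ≤ 1)
    (hs : ∀ x t, Y (x + t • v) = Y x - t) {δ : ℝ} (hδ : 0 < δ) :
    minProb P δ {x | Y x < 0} = minProb (P.map Y) δ {y | y < 0} := by
  have : IsProbabilityMeasure (P.map Y) := Measure.isProbabilityMeasure_map hY.aemeasurable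
  have hL' : ∀ x y, |-Y x - -Y y| ≤ ‖x - y‖ := fun x y => by
    rw [neg_sub_neg, abs_sub_comm]
    exact hL x y
  have hs' : ∀ x t, -Y (x + t • -v) = -Y x - t := fun x t => by
    rw [smul_neg, ← neg_smul, hs]
    ring
  -- Both minima become maxima for the law of `-Y`, seen once from `E` and once from `ℝ` by
  -- reflection.
  have hreal := maxProb_map_eq (P := P.map Y) (Y := fun t : ℝ => -t) (v := 1) measurable_neg
    (fun x y => by rw [neg_sub_neg, abs_sub_comm]; exact le_rfl) (by simp)
    (fun x t => by simp [sub_eq_add_neg, add_comm]) hδ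
  have hYn : Measurable fun x => -Y x := hY.neg
  rw [minProb_eq_one_sub_maxProb_neg hY,
    minProb_eq_one_sub_maxProb_neg (P := P.map Y) (Y := fun t : ℝ => t) measurable_id,
    maxProb_map_eq hYn hL' (by rwa [norm_neg]) hs' hδ, hreal,
    Measure.map_map measurable_neg hY]
  rfl

end Duality

/-! ### Half-spaces in Euclidean space: `v = u` for the maximum, `v = -u` for the minimum. -/

theorem proposition1 {d : ℕ} (P : Measure (EuclideanSpace ℝ (Fin d))) [IsProbabilityMeasure P]
    (δ : ℝ) (hδ : 0 < δ) (z u : EuclideanSpace ℝ (Fin d)) (hu : ‖u‖ = 1) :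
    let Y : EuclideanSpace ℝ (Fin d) → ℝ := fun x => ⟪u, z - x⟫
    let h : ℝ → ℝ := truncExp P Y
    let lam : ℝ≥0∞ := truncInv P Y δ
    let h' : ℝ → ℝ := truncExp P (fun x => -Y x)
    let lam' : ℝ≥0∞ := truncInv P (fun x => -Y x) δ
    let S : ℝ := maxProb P δ {x | 0 ≤ ⟪u, x - z⟫}
    let I : ℝ := minProb P δ {x | 0 < ⟪u, x - z⟫}
    -- the maximization problem
    (S = maxProb (P.map Y) δ {y | y ≤ 0} ∧
      S = (⨅ l : Set.Ioi (0 : ℝ), dualObj P Y δ l) ∧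
      0 < lam ∧
      (lam ≠ ⊤ →
        S = dualObj P Y δ lam.toReal ∧
        S = P.real {x | Y x ≤ lam.toReal} - (h lam.toReal - δ) / lam.toReal ∧
        S = P.real {x | Y x < lam.toReal}
            + (δ - Function.leftLim h lam.toReal) / lam.toReal) ∧
      (lam = ⊤ → S = 1) ∧
      (S = 1 ↔ ∫⁻ x, ENNReal.ofReal (Y x)⁺ ∂P ≤ ENNReal.ofReal δ)) ∧
    -- the minimization problem
    (I = minProb (P.map Y) δ {y | y < 0} ∧
      0 < lam' ∧
      (lam' ≠ ⊤ →
        I = P.real {x | Y x < -lam'.toReal} + (h' lam'.toReal - δ) / lam'.toReal) ∧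
      (lam' = ⊤ → I = 0) ∧
      (I = 0 ↔ ∫⁻ x, ENNReal.ofReal (Y x)⁻ ∂P ≤ ENNReal.ofReal δ)) := by
  intro Y h lam h' lam' S I
  have hY : Measurable Y := by
    have : Continuous Y := by fun_prop
    exact this.measurable
  have hYn : Measurable fun x => -Y x := hY.neg
  have hv : ‖u‖ ≤ 1 := hu.le
  have hL : ∀ x y, |Y x - Y y| ≤ ‖x - y‖ := fun x y => by
    have h1 : Y x - Y y = ⟪u, y - x⟫ := by
      simp only [Y]
      rw [← inner_sub_right, sub_sub_sub_cancel_left]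
    rw [h1, norm_sub_rev]
    refine (abs_real_inner_le_norm _ _).trans ?_
    rw [hu, one_mul]
  have hs : ∀ x (t : ℝ), Y (x + t • u) = Y x - t := fun x t => by
    simp only [Y]
    rw [← sub_sub, inner_sub_right, inner_smul_right, real_inner_self_eq_norm_sq, hu]
    ring
  have hL' : ∀ x y, |-Y x - -Y y| ≤ ‖x - y‖ := fun x y => by
    rw [neg_sub_neg, abs_sub_comm]
    exact hL x y
  have hs' : ∀ x (t : ℝ), -Y (x + t • -u) = -Y x - t := fun x t => by
    rw [smul_neg, ← neg_smul, hs]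
    ring
  have hv' : ‖-u‖ ≤ 1 := by rwa [norm_neg]
  have hneg : ∀ x, ⟪u, x - z⟫ = -Y x := fun x => by
    simp only [Y]
    rw [← inner_neg_right, neg_sub]
  have hS : S = maxProb P δ {x | Y x ≤ 0} := by
    simp only [S, hneg, neg_nonneg]
  have hI : I = minProb P δ {x | Y x < 0} := by
    simp only [I, hneg, neg_pos]
  have hI' : I = 1 - maxProb P δ {x | -Y x ≤ 0} :=
    hI.trans (minProb_eq_one_sub_maxProb_neg hY δ)
  refine ⟨⟨?_, ?_, truncInv_pos hY hδ, fun hlam => ⟨?_, ?_, ?_⟩, fun hlam => ?_, ?_⟩,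
    ?_, truncInv_pos hYn hδ, fun hlam => ?_, fun hlam => ?_, ?_⟩
  · rw [hS, maxProb_map_eq hY hL hv hs hδ]
  · rw [hS, maxProb_eq_iInf_dualObj hY hL hv hs hδ]
  · rw [hS, maxProb_eq_of_truncInv_ne_top hY hL hv hs hδ hlam]
  · rw [hS, maxProb_eq_measureReal_le_sub hY hL hv hs hδ hlam]
  · have hl : 0 < lam.toReal := ENNReal.toReal_pos (truncInv_pos hY hδ).ne' hlam
    rw [hS, maxProb_eq_of_truncInv_ne_top hY hL hv hs hδ hlam, dualObj_eq hY δ hl,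
      leftLim_truncExp hY hl.le]
  · rw [hS]
    exact maxProb_eq_one_of_lintegral_le hY hv hs
      (lintegral_posPart_le_of_truncInv_eq_top hY hδ hlam)
  · rw [hS]
    exact maxProb_eq_one_iff hY hL hv hs hδ
  · rw [hI, minProb_map_eq hY hL hv hs hδ]
  · rw [hI', maxProb_eq_measureReal_le_sub hYn hL' hv' hs' hδ hlam]
    have hc : {x | Y x < -lam'.toReal} = {x | -Y x ≤ lam'.toReal}ᶜ := by
      ext x
      simp [lt_neg]
    rw [hc, probReal_compl_eq_one_sub (s := {x | -Y x ≤ lam'.toReal}) (hYn measurableSet_Iic)]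
    change 1 - (P.real {x | -Y x ≤ lam'.toReal} - (h' lam'.toReal - δ) / lam'.toReal) = _
    ring
  · rw [hI', maxProb_eq_one_of_lintegral_le hYn hv' hs'
      (lintegral_posPart_le_of_truncInv_eq_top hYn hδ hlam), sub_self]
  · rw [hI', sub_eq_zero, eq_comm, maxProb_eq_one_iff hYn hL' hv' hs' hδ]
    simp only [posPart_neg]
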